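/- **The calculus.** Names $\mathtt x,\mathtt y$ are variables $x,y,z$ or store locations $\ell,w$. Qualifiers, effects and observations $p,q,r,o,\varepsilon,\varphi$ are finite sets of names; $\varepsilon_1\rhd\varepsilon_2:=\varepsilon_1\cup\varepsilon_2$. Dependencies $\delta,\Delta$ are finite partial maps from names to names. The syntax is $$\iota::=c\mid\lambda x.(g\bullet\delta)\mid \mathsf{ref}_\ell\,\ell,\quad n::=\iota\mid \mathtt x\,\mathtt x\mid\mathsf{ref}_{\mathtt x}\,\mathtt x\mid{!\mathtt x}\mid\mathtt x:=\mathtt x,\quad g::=\mathtt x\mid \mathsf{let}\ x=b\bullet\delta\ \mathsf{in}\ g,\quad b::=n\mid g,$$ $$T::=B\mid (x:T^q)\to^{\varepsilon}T^q\mid \mathsf{Ref}\,B,\quad \Gamma::=\varnothing\mid\Gamma,x:T^q,\quad \Sigma::=\varnothing\mid\Sigma,\ell:T^q,\quad \sigma::=\varnothing\mid\sigma,\ell=\iota,$$ up to renaming of bound variables, where the base types $B$ include $\mathsf{Unit}$ (with constant $\mathsf{unit}$) and $\mathsf{Alloc}$ (with constant $\omega$), and stores $\sigma$ are regarded as finite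 maps. The parameter of a $\lambda$ is bound in its body and in the body's dependency; in a function type, $x$ is bound in $\varepsilon$ and in the qualified codomain. *Operations.* $\delta\sqsubseteq\delta'$ is the sub-map relation, $\delta|_\alpha$ restriction of the domain, $(\delta_1,\delta_2)$ update with priority for $\delta_2$, and $\alpha\mapsto x$ the map sending all of $\alpha$ to $x$. Rewiring $\delta[x\leadsto\delta']$ replaces each entry $y\mapsto x$ by $y\mapsto\delta'(y)$, or drops it if $y\notin\mathrm{dom}\,\delta'$; $\delta[q/x]$ removes the entry of $x$, if any, and adds $y\mapsto\delta(x)$ for $y\in q$; $q'[p/x]$ replaces $x$, if present, by the elements of $p$. All act homomorphically on types or terms; $[\ell/x]_{\mathsf t}$ renames term occurrences. In a context $\Gamma\mid\Sigma$, $q^*$ is the set of names reachable from $q$ by the reflexive transitive closure of "$\mathtt y$ is in the qualifier of $\mathtt x$", and $\mathord{\bullet\!\!\to} x$ is $(\mathrm{dom}\,\Gamma\cup\mathrm{dom}\,\Sigma)\mapsto x$. We write $\mathtt x:T^q\in[\Gamma\mid\Sigma]^\varphi$ if $\Gamma$ or $\Sigma$ binds $\mathtt x$ to $T^q$ and $\mathtt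 x\in\varphi$. *Subtyping* (in $\Gamma\mid\Sigma$). $p<:q$ iff $p\subseteq q\subseteq\mathrm{dom}\,\Gamma\cup\mathrm{dom}\,\Sigma$; likewise for effects. $B<:B$; $\mathsf{Ref}\,B<:\mathsf{Ref}\,B$; $(x:S^o)\to^{\varepsilon_1}T^q<:(x:U^p)\to^{\varepsilon_2}V^r$ if $U<:S$, $p<:o$, and $T<:V$, $q<:r$, $\varepsilon_1<:\varepsilon_2$ in $\Gamma,x:U^p\mid\Sigma$. *Typing* $[\Gamma\mid\Sigma]^\varphi\bullet\Delta\vdash b:T^q\ \varepsilon$. - $c:B^\varnothing\ \varnothing$ for $c\in B$. - $\lambda x.(g\bullet\delta):((x:T^p)\to^{\varepsilon}U^r)^q\ \varnothing$ if $[\Gamma,x:T^p\mid\Sigma]^{q,x}\bullet\mathord{\bullet\!\!\to} x\vdash g:U^r\ \varepsilon$, $q\subseteq\varphi$ and $\delta\sqsubseteq\varepsilon^*\mapsto x$. - $\mathtt x\,\mathtt y:(U^r\ \varepsilon)[p/z]$ if $\mathtt x:((z:T^{p^*\cap q^*})\to^{\varepsilon}U^r)^q$ and $\mathtt y:T^p$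 are in $[\Gamma\mid\Sigma]^\varphi$, $z\notin\mathrm{fv}(U)$, $\varepsilon\subseteq q,z$ and $r\subseteq\varphi,z$. - $\mathsf{ref}_{\mathtt x}\,\mathtt y:(\mathsf{Ref}\,B)^\varnothing\ \{\mathtt x\}$ if $\mathtt x:\mathsf{Alloc}^q$ and $\mathtt y:B^\varnothing$ are in $[\Gamma\mid\Sigma]^\varphi$. - ${!\mathtt x}:B^\varnothing\ \{\mathtt x\}$ if $\mathtt x:(\mathsf{Ref}\,B)^q\in[\Gamma\mid\Sigma]^\varphi$; and $\mathtt x:=\mathtt y:\mathsf{Unit}^\varnothing\ \{\mathtt x\}$ if moreover $\mathtt y:B^\varnothing\in[\Gamma\mid\Sigma]^\varphi$. - $\mathtt x:T^{\{\mathtt x\}}\ \varnothing$ if $\mathtt x:T^q\in[\Gamma\mid\Sigma]^\varphi$. - $(\mathsf{let}\ x=b\bullet\delta\ \mathsf{in}\ g):(T^q\ \varepsilon_1\rhd\varepsilon_2)[p/x]$ if $[\Gamma\mid\Sigma]^\varphi\bullet\Delta\vdash b:S^p\ \varepsilon_1$, $[\Gamma,x:S^{p^*\cap\varphi^*}\mid\Sigma]^{\varphi,x}\bullet(\Delta,(\varepsilon_1^*,x)\mapsto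 x)\vdash g:T^q\ \varepsilon_2$, $x\notin\mathrm{fv}(T)$ and $\delta\sqsubseteq\Delta|_{\varepsilon_1^*}$. - Subsumption: from $b:S^p\ \varepsilon_1$ infer $b:T^q\ \varepsilon_2$ if $S<:T$, $p<:q$, $\varepsilon_1<:\varepsilon_2$ and $q,\varepsilon_2\subseteq\varphi$. A runtime configuration $\sigma\mid z.g\bullet\delta$ has a start variable $z$ that is bound neither by a typing context nor in $g$. We write $[\Gamma\mid\Sigma]^\varphi\vdash z.g\bullet\delta:T^q\ \varepsilon$ if $[\Gamma\mid\Sigma]^\varphi\bullet\mathord{\bullet\!\!\to} z\vdash g:T^q\ \varepsilon$, $\delta\sqsubseteq\varepsilon\mapsto z$, $q=q^*$ and $\varepsilon=\varepsilon^*$. We write $[\Gamma\mid\Sigma]^\varphi\bullet\Delta\vdash\sigma$ if $\mathrm{dom}\,\sigma=\mathrm{dom}\,\Sigma$ and for every entry $\ell=\iota$ of $\sigma$ either $\iota$ is not a reference and $\iota:T^q\ \varnothing$ for $\Sigma(\ell)=T^q$, or $\iota=\mathsf{ref}_w\,\ell'$ with $\Sigma(\ell)=(\mathsf{Ref}\,B)^\varnothing$,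 $\ell':B^\varnothing\in[\Gamma\mid\Sigma]^\varphi$, $\Sigma(w)=\mathsf{Alloc}^\varnothing$ and $\sigma(w)=\omega$. *Reduction.* With contexts $G::=\square\bullet\delta\mid(\mathsf{let}\ x=G\ \mathsf{in}\ g)\bullet\delta$ and $B::=(\mathsf{let}\ x=\square\ \mathsf{in}\ g)\bullet\delta\mid(\mathsf{let}\ x=B\ \mathsf{in}\ g)\bullet\delta$, call $\delta$ *resolved* in $\sigma$ (for $z$) if $\mathrm{dom}\,\delta\subseteq\mathrm{dom}\,\sigma$ and $\mathrm{cod}\,\delta\subseteq\{z\}$. The steps of $\longrightarrow$ are - $\sigma\mid z.B[\ell_1\,\ell_2\bullet\delta_1]\longrightarrow\sigma\mid z.B[(g\bullet\delta_2)[x\leadsto\delta_1][\ell_2/x][\ell_2/x]_{\mathsf t}]$ if $\sigma(\ell_1)=\lambda x.(g\bullet\delta_2)$ and $\delta_1$ is resolved; - $\sigma\mid z.G[\mathsf{let}\ x=\ell\bullet\delta\ \mathsf{in}\ g]\longrightarrow\sigma\mid z.G[g[x\leadsto\delta][\ell/x][\ell/x]_{\mathsf t}]$ if $\delta$ is resolved;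 - $\sigma\mid z.G[\mathsf{let}\ x=\iota\bullet\delta\ \mathsf{in}\ g]\longrightarrow\sigma,\ell=\iota\mid z.G'[g[x\leadsto\delta][\ell/x][\ell/x]_{\mathsf t}]$ if $\ell\notin\mathrm{dom}\,\sigma$ and $\mathrm{cod}\,\delta\subseteq\{z\}$, where $G'$ is $G$ with all dependencies along its spine updated by $\ell\mapsto z$ if $\iota$ is a reference, and $G'=G$ otherwise; - $\sigma\mid z.B[!\ell\bullet\delta]\longrightarrow\sigma\mid z.B[\ell'\bullet\delta]$ if $\sigma(\ell)=\mathsf{ref}_w\,\ell'$ and $\delta$ is resolved; - $\sigma\mid z.B[\ell:=\ell''\bullet\delta]\longrightarrow\sigma[\ell\mapsto\mathsf{ref}_w\,\ell'']\mid z.B[\mathsf{unit}\bullet\delta]$ if $\sigma(\ell)=\mathsf{ref}_w\,\ell'$ and $\delta$ is resolved. The annotated binding $b\bullet\delta$ displayed on the left ($\ell_1\,\ell_2\bullet\delta_1$, $\ell\bullet\delta$, $\iota\bullet\delta$, …) is the one *executed* by the step. Let $\longrightarrow_u$ be the same relation without the conditions on dependencies ("$\delta$ is resolved", "$\mathrm{cod}\,\delta\subseteq\{z\}$").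 **Corollary (Dependency Safety).** Let $[\varnothing\mid\Sigma]^{\mathrm{dom}\,\Sigma}\vdash z.g\bullet\delta:T^q\ \varepsilon$ and $[\varnothing\mid\Sigma]^{\mathrm{dom}\,\Sigma}\bullet\mathord{\bullet\!\!\to} z\vdash\sigma$, and let $\sigma\mid z.g\bullet\delta\longrightarrow_u^*\sigma'\mid z.g'\bullet\delta'$. Then: 1. Whenever a step $\sigma'\mid z.g'\bullet\delta'\longrightarrow_u C$ executes an annotated binding $b\bullet\delta_b$ (in particular, an effectful graph node), all dependencies in $\delta_b$ are resolved in the store: $\mathrm{dom}\,\delta_b\subseteq\mathrm{dom}\,\sigma'$ and $\mathrm{cod}\,\delta_b\subseteq\{z\}$; and the step is also a step $\sigma'\mid z.g'\bullet\delta'\longrightarrow C$ of the dependency-checking reduction, executing the same binding. 2. Either $g'$ is a location in $\mathrm{dom}\,\sigma'$, or $\sigma'\mid z.g'\bullet\delta'\longrightarrow C$ for some $C$; that is, dependency-checking evaluation is never stuck. -/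

import Mathlib

/-! A graph intermediate representation in monadic normal form, with reachability qualifiers,
effects and (hard) effect dependencies. Term variables are de Bruijn indices, so that terms and
types are identified up to renaming of bound variables. -/

namespace GraphIR

/-! ### Names, qualifiers, types -/

/-- Names: variables (de Bruijn indices), store locations, and block start variables `z` of runtime
configurations. The latter are free variables that are bound in no typing context. -/
inductive Name where
  | var (i : ℕ)
  | loc (l : ℕ)
  | start (z : ℕ)
  deriving DecidableEq

/-- Renaming for the insertion of a new variable with index `k`. -/
def Name.shift (k : ℕ) : Name → Name
  | .var i => if i < k then .var i else .var (i + 1)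
  | .loc l => .loc l
  | .start z => .start z

/-- Renaming for the removal of the variable with index `k`, inverse to `Name.shift k`. -/
def Name.lower (k : ℕ) : Name → Name
  | .var i => if i ≤ k then .var i else .var (i - 1)
  | .loc l => .loc l
  | .start z => .start z

/-- Replacement of the variable with index `k` by the location `l`, followed by its removal. -/
def Name.inst (k l : ℕ) (x : Name) : Name :=
  if x = .var k then .loc l else x.lower k

/-- Qualifiers, effects and observations are finite sets of names. -/
abbrev Qual := Finset Name

/-- Weakening of a qualifier by a new variable with index `k`. -/
def Qual.shift (k : ℕ) (q : Qual) : Qual := q.image (Name.shift k)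

/-- Qualifier substitution `q[p/x]`, where `x` has index `k` and disappears from the context. -/
def Qual.subst (q : Qual) (k : ℕ) (p : Qual) : Qual :=
  if .var k ∈ q then (q.erase (.var k)).image (Name.lower k) ∪ p else q.image (Name.lower k)

/-- Base types: the unit type, the type of the allocation capability, and further ones. -/
inductive BaseTy where
  | unit
  | alloc
  | other (b : ℕ)
  deriving DecidableEq

/-- Constants: the unit value, the allocation capability `ω`, and literals of the other types. -/
inductive Const where
  | unit
  | omega
  | lit (b n : ℕ)
  deriving DecidableEq

/-- The base type of a constant. -/
def Const.ty : Const → BaseTy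
  | .unit => .unit
  | .omega => .alloc
  | .lit b _ => .other b

/-- Types. `fn T p ε U r` is the dependent function type `(x : T^p) →^ε U^r`,
with `x` (index `0`) bound in `ε`, `U` and `r`. -/
inductive Ty where
  | base (B : BaseTy)
  | fn (T : Ty) (p : Qual) (ε : Qual) (U : Ty) (r : Qual)
  | ref (B : BaseTy)

/-- Weakening of a type by a new variable with index `k`. -/
def Ty.shift : ℕ → Ty → Ty
  | _, .base B => .base B
  | k, .fn T p ε U r =>
      .fn (T.shift k) (p.shift k) (ε.shift (k + 1)) (U.shift (k + 1)) (r.shift (k + 1))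
  | _, .ref B => .ref B

/-- The substitution `T[p/x]` of a qualifier for the variable `x` with index `k`. -/
def Ty.subst : ℕ → Qual → Ty → Ty
  | _, _, .base B => .base B
  | k, p, .fn T p' ε U r =>
      .fn (T.subst k p) (p'.subst k p) (ε.subst (k + 1) (p.shift 0))
        (U.subst (k + 1) (p.shift 0)) (r.subst (k + 1) (p.shift 0))
  | _, _, .ref B => .ref B

/-- The variable with index `k` is free in the type. -/
def Ty.HasFree : ℕ → Ty → Prop
  | _, .base _ => False
  | k, .fn T p ε U r =>
      T.HasFree k ∨ .var k ∈ p ∨ .var (k + 1) ∈ ε ∨ U.HasFree (k + 1) ∨ .var (k + 1) ∈ r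
  | _, .ref _ => False

/-! ### Dependency maps -/

/-- Dependency maps: partial functions from names to names, `δ a = some t` standing for `a ↦ t`.
(Those occurring in well-typed terms have a finite domain, by the typing rules.) -/
abbrev Deps := Name → Option Name

namespace Deps

/-- `δ` is a sub-map of `δ'`, written `δ ⊑ δ'`. -/
def Sub (δ δ' : Deps) : Prop := ∀ a t, δ a = some t → δ' a = some t

open Classical in
/-- The map `α ↦ t`, sending every name in `α` to `t`. -/
noncomputable def const (α : Set Name) (t : Name) : Deps :=
  fun a => if a ∈ α then some t else none

open Classical in
/-- The restriction of the domain of `δ` to `α`. -/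
noncomputable def restrict (δ : Deps) (α : Set Name) : Deps :=
  fun a => if a ∈ α then δ a else none

/-- The update `δ₁, δ₂`: entries of `δ₂` take precedence. -/
def update (δ₁ δ₂ : Deps) : Deps := fun a => (δ₂ a).or (δ₁ a)

/-- The rewiring `δ[x ⇝ δ']`: an entry `a ↦ x` becomes `a ↦ δ' a` if `a` is in the domain
of `δ'`, and is dropped otherwise. -/
def rewire (δ : Deps) (x : Name) (δ' : Deps) : Deps :=
  fun a => match δ a with
    | none => none
    | some t => if t = x then δ' a else some t

/-- Qualifier substitution `δ[q/x]` on the domain: the entry of `x`, if any, is moved to all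
names in `q`. -/
def qsubst (δ : Deps) (q : Qual) (x : Name) : Deps :=
  fun a => if a ∈ q ∧ (δ x).isSome then δ x else if a = x then none else δ a

/-- Weakening of a dependency map by a new variable with index `k`. -/
def shift (δ : Deps) (k : ℕ) : Deps :=
  fun a => if a = .var k then none else (δ (a.lower k)).map (Name.shift k)

/-- Removal of the (no longer occurring) variable with index `k`. -/
def lower (δ : Deps) (k : ℕ) : Deps := fun a => (δ (a.shift k)).map (Name.lower k)

/-- `δ[x ⇝ δ'][l/x]` for the variable `x` with index `k`, which disappears from the context. -/
def inst (δ : Deps) (k : ℕ) (δ' : Deps) (l : ℕ) : Deps :=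
  ((δ.rewire (.var k) (δ'.shift k)).qsubst {.loc l} (.var k)).lower k

end Deps

/-! ### Terms -/

/-- The two syntactic categories: graph nodes and graph terms. -/
inductive Kind where
  | node
  | graph

/-- Graph nodes `n` and graph terms `g`. Bindings `b ::= n | g` are terms of arbitrary kind.
`lam g δ` is `λx.(g • δ)` with `x` (index `0`) bound in both `g` and `δ`;
`letin b δ g` is `let x = b • δ in g` with `x` (index `0`) bound in `g` only;
`ref x y` is `ref_x y`, allocating a cell with content `y` through the capability `x`. -/
inductive Tm : Kind → Type where
  | const (c : Const) : Tm .node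
  | lam (g : Tm .graph) (δ : Deps) : Tm .node
  | app (x y : Name) : Tm .node
  | ref (x y : Name) : Tm .node
  | deref (x : Name) : Tm .node
  | assign (x y : Name) : Tm .node
  | ret (x : Name) : Tm .graph
  | letin {k : Kind} (b : Tm k) (δ : Deps) (g : Tm .graph) : Tm .graph

/-- Simultaneous rewiring, qualifier substitution and renaming `t[x ⇝ δ'][l/x][l/x]ₜ`
for the variable `x` with index `i`. -/
def Tm.inst : {k : Kind} → ℕ → Deps → ℕ → Tm k → Tm k
  | _, _, _, _, .const c => .const c
  | _, i, δ', l, .lam g δ => .lam (g.inst (i + 1) (δ'.shift 0) l) (δ.inst (i + 1) (δ'.shift 0) l)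
  | _, i, _, l, .app x y => .app (x.inst i l) (y.inst i l)
  | _, i, _, l, .ref x y => .ref (x.inst i l) (y.inst i l)
  | _, i, _, l, .deref x => .deref (x.inst i l)
  | _, i, _, l, .assign x y => .assign (x.inst i l) (y.inst i l)
  | _, i, _, l, .ret x => .ret (x.inst i l)
  | _, i, δ', l, .letin b δ g =>
      .letin (b.inst i δ' l) (δ.inst i δ' l) (g.inst (i + 1) (δ'.shift 0) l)

/-- Introductions `ι`, the graph nodes that can be committed to the store. -/
inductive Intro where
  | const (c : Const)
  | lam (g : Tm .graph) (δ : Deps)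
  | ref (w l : ℕ)

/-- An introduction as a graph node. -/
def Intro.toNode : Intro → Tm .node
  | .const c => .const c
  | .lam g δ => .lam g δ
  | .ref w l => .ref (.loc w) (.loc l)

/-- The introduction is a reference cell. -/
def Intro.IsRef : Intro → Prop
  | .const _ => False
  | .lam _ _ => False
  | .ref _ _ => True

/-! ### Typing -/

/-- Typing contexts `Γ`, innermost variable first. Each entry lives in the context of the
entries behind it. -/
abbrev Ctx := List (Ty × Qual)

/-- The qualified type of a variable, weakened to the whole context. -/
def Ctx.lookup : Ctx → ℕ → Option (Ty × Qual)
  | [], _ => none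
  | (T, q) :: _, 0 => some (T.shift 0, q.shift 0)
  | _ :: Γ, i + 1 => (Ctx.lookup Γ i).map fun Q => (Q.1.shift 0, Q.2.shift 0)

/-- Store typings `Σ`: finite maps from locations to qualified types. -/
abbrev StoreTy := Finmap fun _ : ℕ => Ty × Qual

/-- The set of locations bound in a store typing. -/
def StoreTy.dom (S : StoreTy) : Qual := S.keys.image Name.loc

/-- The set of names bound in `Γ` and `Σ`. -/
def names (Γ : Ctx) (S : StoreTy) : Set Name :=
  {x | (∃ i < Γ.length, x = .var i) ∨ x ∈ S.dom}

/-- `Bound Γ S x T q`: the context or the store typing assigns `T^q` to `x`. -/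
inductive Bound (Γ : Ctx) (S : StoreTy) : Name → Ty → Qual → Prop
  | var {i T q} : Γ.lookup i = some (T, q) → Bound Γ S (.var i) T q
  | loc {l T q} : S.lookup l = some (T, q) → Bound Γ S (.loc l) T q

/-- Name lookup `x : T^q ∈ [Γ | Σ]^φ`: only observable names can be looked up. -/
def Lookup (Γ : Ctx) (S : StoreTy) (φ : Qual) (x : Name) (T : Ty) (q : Qual) : Prop :=
  Bound Γ S x T q ∧ x ∈ φ

/-- One-step reachability `x ⇝ y`: `y` is in the qualifier assigned to `x`. -/
def Reach (Γ : Ctx) (S : StoreTy) (x y : Name) : Prop :=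
  ∃ T q, Bound Γ S x T q ∧ y ∈ q

/-- Saturation `q*`: the names reachable from `q` in any number of steps. -/
def sat (Γ : Ctx) (S : StoreTy) (q : Qual) : Set Name :=
  {y | ∃ x ∈ q, Relation.ReflTransGen (Reach Γ S) x y}

/-- The map sending all names bound in `Γ` and `Σ` to `x`. -/
noncomputable def pointsTo (Γ : Ctx) (S : StoreTy) (x : Name) : Deps :=
  Deps.const (names Γ S) x

/-- The last uses `Δ, (α, x) ↦ x` after binding a new variable `x` (index `0`) whose effect has
saturation `α`. -/
noncomputable def lastUse (Δ : Deps) (α : Set Name) : Deps :=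
  (Δ.shift 0).update (Deps.const (insert (.var 0) (Name.shift 0 '' α)) (.var 0))

/-- Subtyping `p <: q` of qualifiers and of effects. -/
def QualSub (Γ : Ctx) (S : StoreTy) (p q : Qual) : Prop :=
  p ⊆ q ∧ (q : Set Name) ⊆ names Γ S

/-- Subtyping of types. The first two premises of `fn` are subtyping of the qualified domains
(with empty effects), the other three are subtyping of the qualified codomains with effects. -/
inductive TySub (S : StoreTy) : Ctx → Ty → Ty → Prop
  | base {Γ B} : TySub S Γ (.base B) (.base B)
  | ref {Γ B} : TySub S Γ (.ref B) (.ref B)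
  | fn {Γ T o ε₁ U q T' p ε₂ U' r} :
      TySub S Γ T' T → QualSub Γ S p o →
      TySub S ((T', p) :: Γ) U U' → QualSub ((T', p) :: Γ) S q r →
      QualSub ((T', p) :: Γ) S ε₁ ε₂ →
      TySub S Γ (.fn T o ε₁ U q) (.fn T' p ε₂ U' r)

/-- The typing relation `[Γ | Σ]^φ • Δ ⊢ b : T^q ε` for graph nodes and graph terms. -/
inductive HasType (S : StoreTy) : Ctx → Qual → Deps → {k : Kind} → Tm k → Ty → Qual → Qual → Prop
  | cst {Γ φ Δ} (c : Const) : HasType S Γ φ Δ (.const c) (.base c.ty) ∅ ∅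
  | abs {Γ φ Δ T p g U r ε q δ} :
      HasType S ((T, p) :: Γ) (insert (.var 0) (q.shift 0))
        (pointsTo ((T, p) :: Γ) S (.var 0)) g U r ε →
      q ⊆ φ →
      δ.Sub (Deps.const (sat ((T, p) :: Γ) S ε) (.var 0)) →
      HasType S Γ φ Δ (.lam g δ) (.fn T p ε U r) q ∅
  | app {Γ φ Δ x y T o ε U r q p} :
      Lookup Γ S φ x (.fn T o ε U r) q →
      Lookup Γ S φ y T p →
      (o : Set Name) = sat Γ S p ∩ sat Γ S q →
      ¬ U.HasFree 0 →
      ε ⊆ insert (.var 0) (q.shift 0) →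
      r ⊆ insert (.var 0) (φ.shift 0) →
      HasType S Γ φ Δ (.app x y) (U.subst 0 p) (r.subst 0 p) (ε.subst 0 p)
  | ref {Γ φ Δ x y q B} :
      Lookup Γ S φ x (.base .alloc) q →
      Lookup Γ S φ y (.base B) ∅ →
      HasType S Γ φ Δ (.ref x y) (.ref B) ∅ {x}
  | deref {Γ φ Δ x q B} :
      Lookup Γ S φ x (.ref B) q →
      HasType S Γ φ Δ (.deref x) (.base B) ∅ {x}
  | assign {Γ φ Δ x y q B} :
      Lookup Γ S φ x (.ref B) q →
      Lookup Γ S φ y (.base B) ∅ →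
      HasType S Γ φ Δ (.assign x y) (.base .unit) ∅ {x}
  | ret {Γ φ Δ x T q} :
      Lookup Γ S φ x T q →
      HasType S Γ φ Δ (.ret x) T {x} ∅
  | letin {Γ φ Δ} {k : Kind} {b : Tm k} {T₁ p ε₁} {o : Qual} {g T q ε₂ δ} :
      HasType S Γ φ Δ b T₁ p ε₁ →
      (o : Set Name) = sat Γ S p ∩ sat Γ S φ →
      HasType S ((T₁, o) :: Γ) (insert (.var 0) (φ.shift 0)) (lastUse Δ (sat Γ S ε₁)) g T q ε₂ →
      ¬ T.HasFree 0 →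
      δ.Sub (Δ.restrict (sat Γ S ε₁)) →
      HasType S Γ φ Δ (.letin b δ g) (T.subst 0 p) (q.subst 0 p) (ε₁ ∪ ε₂.subst 0 p)
  | sub {Γ φ Δ} {k : Kind} {b : Tm k} {T₁ p ε₁ T q ε₂} :
      HasType S Γ φ Δ b T₁ p ε₁ →
      TySub S Γ T₁ T → QualSub Γ S p q → QualSub Γ S ε₁ ε₂ →
      q ⊆ φ → ε₂ ⊆ φ →
      HasType S Γ φ Δ b T q ε₂

/-- Well-typed runtime configurations `[Γ | Σ]^φ ⊢ z.g • δ : T^q ε`. -/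
def ConfigTyping (Γ : Ctx) (S : StoreTy) (φ : Qual) (z : ℕ) (g : Tm .graph) (δ : Deps)
    (T : Ty) (q ε : Qual) : Prop :=
  HasType S Γ φ (pointsTo Γ S (.start z)) g T q ε ∧
  δ.Sub (Deps.const (ε : Set Name) (.start z)) ∧
  (q : Set Name) = sat Γ S q ∧ (ε : Set Name) = sat Γ S ε

/-! ### Stores -/

/-- Stores: finite maps from locations to introductions. -/
abbrev Store := Finmap fun _ : ℕ => Intro

/-- Well-formed store entries. -/
inductive EntryTyping (Γ : Ctx) (S : StoreTy) (φ : Qual) (Δ : Deps) (σ : Store) :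
    ℕ → Intro → Prop
  | ref {l w l' B} :
      S.lookup l = some (.ref B, ∅) →
      Lookup Γ S φ (.loc l') (.base B) ∅ →
      S.lookup w = some (.base .alloc, ∅) →
      σ.lookup w = some (.const .omega) →
      EntryTyping Γ S φ Δ σ l (.ref w l')
  | intro {l T q} {ι : Intro} :
      S.lookup l = some (T, q) →
      HasType S Γ φ Δ ι.toNode T q ∅ →
      ¬ ι.IsRef →
      EntryTyping Γ S φ Δ σ l ι

/-- Well-formed stores: the store and its typing bind the same locations, and each entry is
well-formed. -/
def StoreTyping (Γ : Ctx) (S : StoreTy) (φ : Qual) (Δ : Deps) (σ : Store) : Prop :=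
  σ.keys = S.keys ∧ ∀ l ι, σ.lookup l = some ι → EntryTyping Γ S φ Δ σ l ι

/-! ### Reduction -/

/-- Graph term contexts `G ::= □ • δ | (let x = G in g) • δ`. -/
inductive GCtx where
  | hole (δ : Deps)
  | letin (G : GCtx) (g : Tm .graph) (δ : Deps)

/-- Plugging a graph term into the hole, which carries its own dependency. -/
def GCtx.plug : GCtx → Tm .graph → Tm .graph × Deps
  | .hole δ, g => (g, δ)
  | .letin G g' δ, g => (.letin (G.plug g).1 (G.plug g).2 g', δ)

/-- The entry `l ↦ z` is added to all dependencies along the spine of the context. -/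
noncomputable def GCtx.extend (z l : ℕ) : GCtx → GCtx
  | .hole δ => .hole (δ.update (Deps.const {.loc l} (.start z)))
  | .letin G g δ => .letin (G.extend z l) g (δ.update (Deps.const {.loc l} (.start z)))

/-- Contextual effect propagation `G⟨ι : z.l⟩`: only reference allocations have an effect. -/
noncomputable def GCtx.propagate (G : GCtx) (z l : ℕ) : Intro → GCtx
  | .const _ => G
  | .lam _ _ => G
  | .ref _ _ => G.extend z l

/-- Binding contexts `B ::= (let x = □ in g) • δ | (let x = B in g) • δ`. -/
inductive BCtx where
  | hole (g : Tm .graph) (δ : Deps)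
  | letin (B : BCtx) (g : Tm .graph) (δ : Deps)

/-- Plugging a binding, annotated with a dependency, into the hole. -/
def BCtx.plug {k : Kind} : BCtx → Tm k → Deps → Tm .graph × Deps
  | .hole g δ, b, δ' => (.letin b δ' g, δ)
  | .letin B g δ, b, δ' => (.letin (B.plug b δ').1 (B.plug b δ').2 g, δ)

/-- Runtime configurations `σ | z.g • δ`. -/
structure Config where
  store : Store
  start : ℕ
  body : Tm .graph × Deps

/-- Bindings annotated with a dependency, `b • δ`. -/
structure AnnBinding where
  kind : Kind
  binding : Tm kind
  deps : Deps

/-- All targets of the dependency are the start variable: `cod δ ⊆ {z}`. -/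
def CodResolved (z : ℕ) (δ : Deps) : Prop := ∀ a t, δ a = some t → t = .start z

/-- All dependencies are on store locations: `dom δ ⊆ dom σ`. -/
def DomResolved (σ : Store) (δ : Deps) : Prop :=
  ∀ a t, δ a = some t → ∃ l, l ∈ σ ∧ a = .loc l

/-- The dependency is resolved in the store: `dom δ ⊆ dom σ` and `cod δ ⊆ {z}`. -/
def Resolved (σ : Store) (z : ℕ) (δ : Deps) : Prop := DomResolved σ δ ∧ CodResolved z δ

/-- Reduction with or without runtime dependency checking. -/
inductive Mode where
  | checked
  | unchecked

/-- Call-by-value reduction `σ | z.g • δ ⟶ σ' | z.g' • δ'`, labelled by the annotated binding that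
is executed in the step. With mode `checked` this is the dependency-checking reduction of the
calculus; with mode `unchecked` all side conditions on dependencies are dropped. -/
inductive Step (m : Mode) : Config → AnnBinding → Config → Prop
  | beta {σ : Store} {z l₁ l₂ : ℕ} {B : BCtx} {g : Tm .graph} {δ₁ δ₂ : Deps} :
      σ.lookup l₁ = some (.lam g δ₂) →
      (m = .checked → Resolved σ z δ₁) →
      Step m ⟨σ, z, B.plug (.app (.loc l₁) (.loc l₂)) δ₁⟩
        ⟨.node, .app (.loc l₁) (.loc l₂), δ₁⟩
        ⟨σ, z, B.plug (g.inst 0 δ₁ l₂) (δ₂.inst 0 δ₁ l₂)⟩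
  | letloc {σ : Store} {z l : ℕ} {G : GCtx} {g : Tm .graph} {δ : Deps} :
      (m = .checked → Resolved σ z δ) →
      Step m ⟨σ, z, G.plug (.letin (.ret (.loc l)) δ g)⟩
        ⟨.graph, .ret (.loc l), δ⟩
        ⟨σ, z, G.plug (g.inst 0 δ l)⟩
  | intro {σ : Store} {z l : ℕ} {G : GCtx} {ι : Intro} {g : Tm .graph} {δ : Deps} :
      l ∉ σ →
      (m = .checked → CodResolved z δ) →
      Step m ⟨σ, z, G.plug (.letin ι.toNode δ g)⟩
        ⟨.node, ι.toNode, δ⟩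
        ⟨σ.insert l ι, z, (G.propagate z l ι).plug (g.inst 0 δ l)⟩
  | deref {σ : Store} {z l w l' : ℕ} {B : BCtx} {δ : Deps} :
      σ.lookup l = some (.ref w l') →
      (m = .checked → Resolved σ z δ) →
      Step m ⟨σ, z, B.plug (.deref (.loc l)) δ⟩
        ⟨.node, .deref (.loc l), δ⟩
        ⟨σ, z, B.plug (.ret (.loc l')) δ⟩
  | assign {σ : Store} {z l w l' l'' : ℕ} {B : BCtx} {δ : Deps} :
      σ.lookup l = some (.ref w l') →
      (m = .checked → Resolved σ z δ) →
      Step m ⟨σ, z, B.plug (.assign (.loc l) (.loc l'')) δ⟩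
        ⟨.node, .assign (.loc l) (.loc l''), δ⟩
        ⟨σ.insert l (.ref w l''), z, B.plug (.const .unit) δ⟩

/-- Evaluation: finitely many reduction steps. -/
def Reaches (m : Mode) : Config → Config → Prop :=
  Relation.ReflTransGen fun C C' => ∃ e, Step m C e C'

/-- Final configurations: the graph term is a location in the store. -/
def Config.IsFinal (C : Config) : Prop := ∃ l, l ∈ C.store ∧ C.body.1 = .ret (.loc l)

end GraphIR

namespace GraphIR

/-! ### Simple types -/

/-- Types without qualifiers and effects. -/
inductive SimpleTy where
  | base (B : BaseTy)
  | fn (A B : SimpleTy)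
  | ref (B : BaseTy)

/-- Erasure of qualifiers and effects. -/
def Ty.erase : Ty → SimpleTy
  | .base B => .base B
  | .fn T _ _ U _ => .fn T.erase U.erase
  | .ref B => .ref B

theorem Ty.erase_shift (T : Ty) (k : ℕ) : (T.shift k).erase = T.erase := by
  induction T generalizing k with
  | base B => rfl
  | fn T p ε U r ihT ihU => simp [Ty.shift, Ty.erase, ihT, ihU]
  | ref B => rfl

theorem Ty.erase_subst (T : Ty) (k : ℕ) (p : Qual) : (T.subst k p).erase = T.erase := by
  induction T generalizing k p with
  | base B => rfl
  | fn T p ε U r ihT ihU => simp [Ty.subst, Ty.erase, ihT, ihU]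
  | ref B => rfl

/-- Subtyping changes only qualifiers and effects, so subsumption becomes invisible after erasure.
-/
theorem TySub.erase_eq {S : StoreTy} {Γ : Ctx} {T U : Ty} (h : TySub S Γ T U) :
    T.erase = U.erase := by
  induction h with
  | base => rfl
  | ref => rfl
  | fn _ _ _ _ _ ih₁ ih₂ => simp [Ty.erase, ih₁, ih₂]

/-- Erasure of typing contexts. -/
def Ctx.erase (Γ : Ctx) : List SimpleTy := Γ.map fun Q => Q.1.erase

/-- Simple store typings. -/
abbrev SimpleStoreTy := ℕ → Option SimpleTy

/-- Erasure of store typings. -/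
def StoreTy.erase (S : StoreTy) : SimpleStoreTy := fun l => (S.lookup l).map fun Q => Q.1.erase

/-- The simple type of a name. -/
def nameTy (Ψ : SimpleStoreTy) (Γ : List SimpleTy) : Name → Option SimpleTy
  | .var i => Γ[i]?
  | .loc l => Ψ l
  | .start _ => none

theorem Ctx.erase_lookup {Γ : Ctx} {i : ℕ} {Q : Ty × Qual} (h : Γ.lookup i = some Q) :
    Γ.erase[i]? = some Q.1.erase := by
  induction Γ generalizing i Q with
  | nil => simp [Ctx.lookup] at h
  | cons P Γ ih =>
    cases i with
    | zero =>
      simp only [Ctx.lookup, Option.some.injEq] at h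
      subst h
      simp [Ctx.erase, Ty.erase_shift]
    | succ i =>
      simp only [Ctx.lookup, Option.map_eq_some_iff] at h
      obtain ⟨P', hP, rfl⟩ := h
      simpa [Ctx.erase, Ty.erase_shift] using ih hP

theorem Bound.nameTy_eq {Γ : Ctx} {S : StoreTy} {x : Name} {T : Ty} {q : Qual}
    (h : Bound Γ S x T q) : nameTy S.erase Γ.erase x = some T.erase := by
  cases h with
  | var h => exact Ctx.erase_lookup h
  | loc h => simp [nameTy, StoreTy.erase, h]

theorem isSome_nameTy_of_mem_names {Γ : Ctx} {S : StoreTy} {x : Name} (h : x ∈ names Γ S) :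
    (nameTy S.erase Γ.erase x).isSome := by
  rcases h with ⟨i, hi, rfl⟩ | h
  · simpa [nameTy, Ctx.erase] using hi
  · simp only [StoreTy.dom, Finset.mem_image, Finmap.mem_keys] at h
    obtain ⟨l, hl, rfl⟩ := h
    obtain ⟨Q, hQ⟩ := Finmap.mem_iff.1 hl
    simp [nameTy, StoreTy.erase, hQ]

/-! ### Scoping of dependencies -/

/-- Every entry of the dependency points either to a bound variable, or from a name in scope to
the start variable `z`. -/
def DepScoped (z : ℕ) (Ψ : SimpleStoreTy) (Γ : List SimpleTy) (δ : Deps) : Prop :=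
  ∀ a t, δ a = some t →
    (t = .start z ∧ (nameTy Ψ Γ a).isSome) ∨ ∃ i < Γ.length, t = .var i

theorem DepScoped.of_sub {z : ℕ} {Ψ : SimpleStoreTy} {Γ : List SimpleTy} {δ δ' : Deps}
    (h : DepScoped z Ψ Γ δ') (hs : δ.Sub δ') : DepScoped z Ψ Γ δ :=
  fun a t e => h a t (hs a t e)

theorem DepScoped.restrict {z : ℕ} {Ψ : SimpleStoreTy} {Γ : List SimpleTy} {δ : Deps}
    (h : DepScoped z Ψ Γ δ) (α : Set Name) : DepScoped z Ψ Γ (δ.restrict α) := by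
  intro a t e
  unfold Deps.restrict at e
  split_ifs at e
  exact h a t e

/-- The source set is arbitrary: a source is inspected only once the target variable has been
rewired away. This is why no saturation needs to be computed. -/
theorem DepScoped.const_var {z : ℕ} {Ψ : SimpleStoreTy} {Γ : List SimpleTy} {i : ℕ}
    (hi : i < Γ.length) (α : Set Name) : DepScoped z Ψ Γ (Deps.const α (.var i)) := by
  intro a t e
  unfold Deps.const at e
  split_ifs at e
  exact Or.inr ⟨i, hi, (Option.some.inj e).symm⟩

theorem DepScoped.const_start {z : ℕ} {Ψ : SimpleStoreTy} {Γ : List SimpleTy} {α : Set Name}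
    (h : ∀ a ∈ α, (nameTy Ψ Γ a).isSome) : DepScoped z Ψ Γ (Deps.const α (.start z)) := by
  intro a t e
  unfold Deps.const at e
  split_ifs at e with ha
  exact Or.inl ⟨(Option.some.inj e).symm, h a ha⟩

theorem DepScoped.update {z : ℕ} {Ψ : SimpleStoreTy} {Γ : List SimpleTy} {δ δ' : Deps}
    (h : DepScoped z Ψ Γ δ) (h' : DepScoped z Ψ Γ δ') : DepScoped z Ψ Γ (δ.update δ') := by
  intro a t e
  rcases Option.or_eq_some_iff.1 e with e | ⟨-, e⟩
  · exact h' a t e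
  · exact h a t e

/-! ### Weakening, rewiring and instantiation of dependencies. -/

theorem nameTy_append_shift (Ψ : SimpleStoreTy) (Γ Γ' : List SimpleTy) (A : SimpleTy) (x : Name) :
    nameTy Ψ (Γ' ++ A :: Γ) (x.shift Γ'.length) = nameTy Ψ (Γ' ++ Γ) x := by
  cases x with
  | var i =>
    simp only [Name.shift]
    split_ifs with h
    · simp [nameTy, List.getElem?_append_left h]
    · simp only [nameTy]
      rw [List.getElem?_append_right (by omega), List.getElem?_append_right (by omega),
        show i + 1 - Γ'.length = (i - Γ'.length) + 1 by omega, List.getElem?_cons_succ]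
  | loc l => rfl
  | start z => rfl

theorem Name.shift_lower {x : Name} {k : ℕ} (h : x ≠ .var k) : (x.lower k).shift k = x := by
  cases x with
  | var i =>
    have : i ≠ k := fun e => h (e ▸ rfl)
    simp only [Name.lower]
    split_ifs
    · rw [Name.shift, if_pos (by omega)]
    · rw [Name.shift, if_neg (by omega), Nat.sub_add_cancel (by omega)]
  | loc l => rfl
  | start z => rfl

theorem DepScoped.shift {z : ℕ} {Ψ : SimpleStoreTy} {Γ : List SimpleTy} {δ : Deps}
    (h : DepScoped z Ψ Γ δ) (A : SimpleTy) : DepScoped z Ψ (A :: Γ) (δ.shift 0) := by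
  intro a t e
  unfold Deps.shift at e
  split_ifs at e with ha
  obtain ⟨u, hu, rfl⟩ := Option.map_eq_some_iff.1 e
  rcases h _ _ hu with ⟨rfl, hs⟩ | ⟨i, hi, rfl⟩
  · refine Or.inl ⟨rfl, ?_⟩
    rw [← Name.shift_lower ha]
    exact (nameTy_append_shift Ψ Γ [] A _).symm ▸ hs
  · exact Or.inr ⟨i + 1, by simpa using hi, by simp [Name.shift]⟩

theorem DepScoped.lastUse {z : ℕ} {Ψ : SimpleStoreTy} {Γ : List SimpleTy} {δ : Deps}
    (h : DepScoped z Ψ Γ δ) (A : SimpleTy) (α : Set Name) :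
    DepScoped z Ψ (A :: Γ) (lastUse δ α) :=
  (h.shift A).update (.const_var (by simp) _)

/-- All entries of the dependency map a location of the store typing to the start variable. -/
def DepClosed (z : ℕ) (Ψ : SimpleStoreTy) (δ : Deps) : Prop :=
  ∀ a t, δ a = some t → t = .start z ∧ ∃ l, a = .loc l ∧ (Ψ l).isSome

/-- With no variables bound, the only names in scope are the typed locations. -/
theorem depScoped_nil_iff {z : ℕ} {Ψ : SimpleStoreTy} {δ : Deps} :
    DepScoped z Ψ [] δ ↔ DepClosed z Ψ δ := by
  constructor
  · intro h a t e
    rcases h a t e with ⟨rfl, hs⟩ | ⟨i, hi, -⟩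
    · refine ⟨rfl, ?_⟩
      cases a with
      | var i => simp [nameTy] at hs
      | loc l => exact ⟨l, rfl, hs⟩
      | start z => simp [nameTy] at hs
    · simp at hi
  · intro h a t e
    obtain ⟨rfl, l, rfl, hl⟩ := h a t e
    exact Or.inl ⟨rfl, hl⟩

theorem DepClosed.shift {z : ℕ} {Ψ : SimpleStoreTy} {δ : Deps} (h : DepClosed z Ψ δ) (k : ℕ) :
    DepClosed z Ψ (δ.shift k) := by
  intro a t e
  unfold Deps.shift at e
  split_ifs at e with ha
  obtain ⟨u, hu, rfl⟩ := Option.map_eq_some_iff.1 e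
  obtain ⟨rfl, l, hl, hs⟩ := h _ _ hu
  refine ⟨rfl, l, ?_, hs⟩
  rw [← Name.shift_lower ha, hl]
  rfl

/-- A rewired entry is an entry of the closed map, hence scoped even if the source of the original
entry was not. -/
theorem DepScoped.rewire {z : ℕ} {Ψ : SimpleStoreTy} {Γ : List SimpleTy} {δ δ' : Deps} (x : Name)
    (h : DepScoped z Ψ Γ δ) (h' : DepClosed z Ψ δ') :
    DepScoped z Ψ Γ (δ.rewire x δ') := by
  intro a t e
  unfold Deps.rewire at e
  cases hδ : δ a with
  | none => simp [hδ] at e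
  | some u =>
    simp only [hδ] at e
    split_ifs at e with hu
    · obtain ⟨rfl, l, rfl, hl⟩ := h' a t e
      exact Or.inl ⟨rfl, hl⟩
    · exact h a t (hδ.trans e)

/-- Entries that pointed to the variable now point to the start variable or are gone, so its index
can be removed without capturing a target. -/
theorem rewire_ne {z : ℕ} {Ψ : SimpleStoreTy} {δ δ' : Deps} {k : ℕ} (h' : DepClosed z Ψ δ')
    {a t : Name} (e : δ.rewire (.var k) δ' a = some t) : t ≠ .var k := by
  rintro rfl
  unfold Deps.rewire at e
  cases hδ : δ a with
  | none => simp [hδ] at e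
  | some u =>
    simp only [hδ] at e
    split_ifs at e with hu
    · cases (h' _ _ e).1
    · exact hu (Option.some.inj e)

/-- Rewiring removes the variable as a target, and the qualifier substitution moves its own entry to
`l`, which is in scope by `hl`. The prefix `Γ'` holds the binders crossed inside the term. -/
theorem DepScoped.inst {z : ℕ} {Ψ : SimpleStoreTy} {Γ Γ' : List SimpleTy} {A : SimpleTy}
    {δ δ' : Deps} {l : ℕ} (h : DepScoped z Ψ (Γ' ++ A :: Γ) δ) (h' : DepClosed z Ψ δ')
    (hl : Ψ l = some A) : DepScoped z Ψ (Γ' ++ Γ) (δ.inst Γ'.length δ' l) := by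
  intro a t e
  unfold Deps.inst Deps.lower at e
  obtain ⟨u, hu, rfl⟩ := Option.map_eq_some_iff.1 e
  clear e
  have hr := h.rewire (.var Γ'.length) (h'.shift Γ'.length)
  -- Here `u` is the target before its index is lowered, while the source `a` is already a name of
  -- the smaller context.
  have key : u ≠ .var Γ'.length ∧ ((u = .start z ∧ (nameTy Ψ (Γ' ++ Γ) a).isSome) ∨
      ∃ i < (Γ' ++ A :: Γ).length, u = .var i) := by
    unfold Deps.qsubst at hu
    split_ifs at hu with h₁ h₂
    · refine ⟨rewire_ne (h'.shift _) hu, ?_⟩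
      refine (hr _ _ hu).imp_left fun ⟨ht, _⟩ => ⟨ht, ?_⟩
      rw [← nameTy_append_shift Ψ Γ Γ' A, Finset.mem_singleton.1 h₁.1]
      simp [nameTy, hl]
    · refine ⟨rewire_ne (h'.shift _) hu, ?_⟩
      rw [← nameTy_append_shift Ψ Γ Γ' A]
      exact hr _ _ hu
  obtain ⟨hne, ⟨rfl, hs⟩ | ⟨i, hi, rfl⟩⟩ := key
  · exact Or.inl ⟨rfl, hs⟩
  · have hik : i ≠ Γ'.length := fun e => hne (e ▸ rfl)
    simp only [List.length_append, List.length_cons] at hi ⊢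
    right
    simp only [Name.lower]
    split_ifs
    · exact ⟨i, by omega, rfl⟩
    · exact ⟨i - 1, by omega, rfl⟩

/-- Extension of simple store typings. -/
def SimpleStoreTy.Le (Ψ Ψ' : SimpleStoreTy) : Prop := ∀ l A, Ψ l = some A → Ψ' l = some A

theorem SimpleStoreTy.Le.nameTy {Ψ Ψ' : SimpleStoreTy} (h : Ψ.Le Ψ') {Γ : List SimpleTy}
    {x : Name} {A : SimpleTy} (hx : nameTy Ψ Γ x = some A) : nameTy Ψ' Γ x = some A := by
  cases x with
  | var i => exact hx
  | loc l => exact h l A hx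
  | start z => exact hx

theorem DepScoped.mono {z : ℕ} {Ψ Ψ' : SimpleStoreTy} {Γ : List SimpleTy} {δ : Deps}
    (h : DepScoped z Ψ Γ δ) (hle : Ψ.Le Ψ') : DepScoped z Ψ' Γ δ := by
  intro a t e
  refine (h a t e).imp_left fun ⟨ht, hs⟩ => ⟨ht, ?_⟩
  obtain ⟨A, hA⟩ := Option.isSome_iff_exists.1 hs
  simp [hle.nameTy hA]

/-! ### Simple typing with scoped dependencies -/

/-- Simple typing of terms all of whose dependencies are scoped. -/
inductive Scoped (z : ℕ) (Ψ : SimpleStoreTy) :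
    List SimpleTy → {k : Kind} → Tm k → SimpleTy → Prop
  | const {Γ} (c : Const) : Scoped z Ψ Γ (.const c) (.base c.ty)
  | lam {Γ g δ A B} :
      Scoped z Ψ (A :: Γ) g B → DepScoped z Ψ (A :: Γ) δ → Scoped z Ψ Γ (.lam g δ) (.fn A B)
  | app {Γ x y A B} :
      nameTy Ψ Γ x = some (.fn A B) → nameTy Ψ Γ y = some A → Scoped z Ψ Γ (.app x y) B
  | ref {Γ x y B} :
      nameTy Ψ Γ x = some (.base .alloc) → nameTy Ψ Γ y = some (.base B) →
      Scoped z Ψ Γ (.ref x y) (.ref B)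
  | deref {Γ x B} : nameTy Ψ Γ x = some (.ref B) → Scoped z Ψ Γ (.deref x) (.base B)
  | assign {Γ x y B} :
      nameTy Ψ Γ x = some (.ref B) → nameTy Ψ Γ y = some (.base B) →
      Scoped z Ψ Γ (.assign x y) (.base .unit)
  | ret {Γ x A} : nameTy Ψ Γ x = some A → Scoped z Ψ Γ (.ret x) A
  | letin {Γ} {k : Kind} {b : Tm k} {δ g A B} :
      Scoped z Ψ Γ b A → DepScoped z Ψ Γ δ → Scoped z Ψ (A :: Γ) g B →
      Scoped z Ψ Γ (.letin b δ g) B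

/-- The invariant is that the last-use map is scoped. A λ-body starts from a map into its parameter,
and a `let` adds only entries pointing to the new variable, so both keep it whatever the effects
are. -/
theorem HasType.scoped {S : StoreTy} {Γ : Ctx} {φ : Qual} {Δ : Deps} {k : Kind} {t : Tm k}
    {T : Ty} {q ε : Qual} (h : HasType S Γ φ Δ t T q ε) {z : ℕ}
    (hΔ : DepScoped z S.erase Γ.erase Δ) : Scoped z S.erase Γ.erase t T.erase := by
  induction h with
  | cst c => exact .const c
  | abs _ _ hδ ih =>
    exact .lam (ih (.const_var (by simp [Ctx.erase]) _))
      (.of_sub (.const_var (by simp [Ctx.erase]) _) hδ)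
  | app hx hy => rw [Ty.erase_subst]; exact .app hx.1.nameTy_eq hy.1.nameTy_eq
  | ref hx hy => exact .ref hx.1.nameTy_eq hy.1.nameTy_eq
  | deref hx => exact .deref hx.1.nameTy_eq
  | assign hx hy => exact .assign hx.1.nameTy_eq hy.1.nameTy_eq
  | ret hx => exact .ret hx.1.nameTy_eq
  | letin _ _ _ _ hδ ihb ihg =>
    rw [Ty.erase_subst]
    exact .letin (ihb hΔ) (.of_sub (hΔ.restrict _) hδ) (ihg (hΔ.lastUse _ _))
  | sub _ hT _ _ _ _ ih => rw [← hT.erase_eq]; exact ih hΔ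

theorem Scoped.mono {z : ℕ} {Ψ Ψ' : SimpleStoreTy} (hle : Ψ.Le Ψ') {Γ : List SimpleTy} {k : Kind}
    {t : Tm k} {A : SimpleTy} (h : Scoped z Ψ Γ t A) : Scoped z Ψ' Γ t A := by
  induction h with
  | const c => exact .const c
  | lam _ hδ ih => exact .lam ih (hδ.mono hle)
  | app hx hy => exact .app (hle.nameTy hx) (hle.nameTy hy)
  | ref hx hy => exact .ref (hle.nameTy hx) (hle.nameTy hy)
  | deref hx => exact .deref (hle.nameTy hx)
  | assign hx hy => exact .assign (hle.nameTy hx) (hle.nameTy hy)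
  | ret hx => exact .ret (hle.nameTy hx)
  | letin _ hδ _ ihb ihg => exact .letin ihb (hδ.mono hle) ihg

theorem nameTy_inst {Ψ : SimpleStoreTy} {Γ Γ' : List SimpleTy} {A B : SimpleTy} {x : Name} {l : ℕ}
    (hl : Ψ l = some A) (hx : nameTy Ψ (Γ' ++ A :: Γ) x = some B) :
    nameTy Ψ (Γ' ++ Γ) (x.inst Γ'.length l) = some B := by
  unfold Name.inst
  split_ifs with h
  · subst h
    simp only [nameTy, List.getElem?_append_right le_rfl, Nat.sub_self,
      List.getElem?_cons_zero] at hx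
    exact hl.trans hx
  · rw [← nameTy_append_shift Ψ Γ Γ' A, Name.shift_lower h]
    exact hx

theorem Scoped.inst {z : ℕ} {Ψ : SimpleStoreTy} {Γ Γ' : List SimpleTy} {A B : SimpleTy} {k : Kind}
    {t : Tm k} {δ' : Deps} {l : ℕ} (h : Scoped z Ψ (Γ' ++ A :: Γ) t B) (h' : DepClosed z Ψ δ')
    (hl : Ψ l = some A) : Scoped z Ψ (Γ' ++ Γ) (t.inst Γ'.length δ' l) B := by
  generalize hΓ : Γ' ++ A :: Γ = Γ₀ at h
  induction h generalizing Γ' δ' with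
  | const c => exact .const c
  | @lam _ _ _ A' _ _ hδ ih =>
    subst hΓ
    exact .lam (ih (Γ' := A' :: Γ') (h'.shift 0) rfl)
      (DepScoped.inst (Γ' := A' :: Γ') hδ (h'.shift 0) hl)
  | app hx hy => subst hΓ; exact .app (nameTy_inst hl hx) (nameTy_inst hl hy)
  | ref hx hy => subst hΓ; exact .ref (nameTy_inst hl hx) (nameTy_inst hl hy)
  | deref hx => subst hΓ; exact .deref (nameTy_inst hl hx)
  | assign hx hy => subst hΓ; exact .assign (nameTy_inst hl hx) (nameTy_inst hl hy)
  | ret hx => subst hΓ; exact .ret (nameTy_inst hl hx)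
  | @letin _ _ _ _ _ A' _ _ hδ _ ihb ihg =>
    subst hΓ
    exact .letin (ihb h' rfl) (hδ.inst h' hl) (ihg (Γ' := A' :: Γ') (h'.shift 0) rfl)

/-! ### Reduction contexts -/

/-- Inversion and replacement at once. The hole is under no binder, so its content is typed in the
empty context and its annotation is closed. -/
theorem BCtx.scoped_plug {z : ℕ} {Ψ : SimpleStoreTy} {B : BCtx} {k : Kind} {b : Tm k} {δ : Deps}
    {A : SimpleTy} (h : Scoped z Ψ [] (B.plug b δ).1 A) :
    DepClosed z Ψ δ ∧ ∃ A', Scoped z Ψ [] b A' ∧ ∀ {k' : Kind} {b' : Tm k'} {δ' : Deps},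
      Scoped z Ψ [] b' A' → DepScoped z Ψ [] δ' → Scoped z Ψ [] (B.plug b' δ').1 A := by
  induction B generalizing A with
  | hole g δ₀ =>
    cases h with
    | letin hb hδ hg => exact ⟨depScoped_nil_iff.1 hδ, _, hb, fun hb' hδ' => .letin hb' hδ' hg⟩
  | letin B g δ₀ ih =>
    cases h with
    | letin hb hδ hg =>
      obtain ⟨hc, A', hb', hplug⟩ := ih hb
      refine ⟨hc, A', hb', fun h₁ h₂ => .letin (hplug h₁ h₂) ?_ hg⟩
      -- The annotation of a plugged context is stored in the context and does not depend on the
      -- content; the case split makes it compute.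
      cases B <;> exact hδ

/-- Allocation enlarges the store typing, so replacement is allowed at any extension. The outermost
annotation is not part of the term and stays unconstrained. -/
theorem GCtx.scoped_plug {z : ℕ} {Ψ : SimpleStoreTy} {G : GCtx} {g : Tm .graph}
    {A : SimpleTy} (h : Scoped z Ψ [] (G.plug g).1 A) :
    ∃ A', Scoped z Ψ [] g A' ∧ ∀ {Ψ' : SimpleStoreTy} {g' : Tm .graph}, Ψ.Le Ψ' →
      Scoped z Ψ' [] g' A' → Scoped z Ψ' [] (G.plug g').1 A ∧
      ∀ l, (Ψ' l).isSome → Scoped z Ψ' [] ((G.extend z l).plug g').1 A := by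
  induction G generalizing A with
  | hole δ => exact ⟨A, h, fun _ hg' => ⟨hg', fun _ _ => hg'⟩⟩
  | letin G g₀ δ ih =>
    cases h with
    | letin hb hδ hg =>
      obtain ⟨A', hb', hplug⟩ := ih hb
      refine ⟨A', hb', fun hle h₁ => ⟨.letin (hplug hle h₁).1 ?_ (hg.mono hle), fun l hl =>
        .letin ((hplug hle h₁).2 l hl) ?_ (hg.mono hle)⟩⟩
      · cases G <;> exact hδ.mono hle
      · have hc : DepScoped z _ [] (Deps.const {.loc l} (.start z)) :=
          .const_start (by rintro a rfl; exact hl)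
        cases G <;> exact (hδ.mono hle).update hc

theorem GCtx.scoped_propagate {z : ℕ} {Ψ : SimpleStoreTy} {G : GCtx} {g : Tm .graph}
    {A : SimpleTy} {l : ℕ} (ι : Intro) (h : Scoped z Ψ [] (G.plug g).1 A)
    (he : Scoped z Ψ [] ((G.extend z l).plug g).1 A) :
    Scoped z Ψ [] ((G.propagate z l ι).plug g).1 A := by
  cases ι with
  | const c => exact h
  | lam g δ => exact h
  | ref w l' => exact he

theorem GCtx.scoped_plug_letin {z : ℕ} {Ψ : SimpleStoreTy} {G : GCtx} {k : Kind} {b : Tm k}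
    {δ : Deps} {g : Tm .graph} {A : SimpleTy} (h : Scoped z Ψ [] (G.plug (.letin b δ g)).1 A) :
    DepClosed z Ψ δ := by
  obtain ⟨A', h', -⟩ := G.scoped_plug h
  cases h' with
  | letin _ hδ _ => exact depScoped_nil_iff.1 hδ

/-! ### Safety -/

/-- The store has an entry of the right type for every location of the store typing. -/
def StoreScoped (z : ℕ) (Ψ : SimpleStoreTy) (σ : Store) : Prop :=
  ∀ l A, Ψ l = some A → ∃ ι, σ.lookup l = some ι ∧ Scoped z Ψ [] ι.toNode A

/-- Simply typed configurations with scoped dependencies and start variable `z`. -/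
def Config.Scoped (z : ℕ) (C : Config) : Prop :=
  C.start = z ∧ ∃ Ψ A, StoreScoped z Ψ C.store ∧ GraphIR.Scoped z Ψ [] C.body.1 A

theorem StoreTyping.storeScoped {S : StoreTy} {σ : Store} {z : ℕ} {φ : Qual}
    (h : StoreTyping [] S φ (pointsTo [] S (.start z)) σ) : StoreScoped z S.erase σ := by
  intro l A hA
  obtain ⟨Q, hQ, rfl⟩ := Option.map_eq_some_iff.1 hA
  have hl : l ∈ σ := by
    rw [← Finmap.mem_keys, h.1, Finmap.mem_keys]
    exact Finmap.mem_of_lookup_eq_some hQ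
  obtain ⟨ι, hι⟩ := Finmap.mem_iff.1 hl
  refine ⟨ι, hι, ?_⟩
  cases h.2 l ι hι with
  | ref hl hl' hw _ =>
    rw [Option.some.inj (hQ.symm.trans hl)]
    exact .ref (Bound.nameTy_eq (Γ := []) (.loc hw)) hl'.1.nameTy_eq
  | intro hl ht _ =>
    rw [Option.some.inj (hQ.symm.trans hl)]
    exact ht.scoped (.const_start fun _ => isSome_nameTy_of_mem_names)

theorem StoreScoped.resolved {z : ℕ} {Ψ : SimpleStoreTy} {σ : Store} {δ : Deps}
    (hσ : StoreScoped z Ψ σ) (hδ : DepClosed z Ψ δ) : Resolved σ z δ := by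
  refine ⟨fun a t e => ?_, fun a t e => (hδ a t e).1⟩
  obtain ⟨-, l, rfl, hl⟩ := hδ a t e
  obtain ⟨A, hA⟩ := Option.isSome_iff_exists.1 hl
  obtain ⟨ι, hι, -⟩ := hσ l A hA
  exact ⟨l, Finmap.mem_of_lookup_eq_some hι, rfl⟩

/-! ### Agreement of the two reductions, and preservation. -/

/-- The executed annotation sits inside a `let` in the empty context, so it is closed and the
dropped side condition holds automatically. -/
theorem Step.resolved {z : ℕ} {m : Mode} {C C' : Config} {e : AnnBinding} (h : Step m C e C')
    (hC : C.Scoped z) : Resolved C.store z e.deps ∧ Step .checked C e C' := by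
  obtain ⟨rfl, Ψ, A, hσ, hg⟩ := hC
  cases h with
  | beta h₁ _ =>
    have hr := hσ.resolved (BCtx.scoped_plug hg).1
    exact ⟨hr, .beta h₁ fun _ => hr⟩
  | letloc _ =>
    have hr := hσ.resolved (GCtx.scoped_plug_letin hg)
    exact ⟨hr, .letloc fun _ => hr⟩
  | intro h₁ _ =>
    have hr := hσ.resolved (GCtx.scoped_plug_letin hg)
    exact ⟨hr, .intro h₁ fun _ => hr.2⟩
  | deref h₁ _ =>
    have hr := hσ.resolved (BCtx.scoped_plug hg).1
    exact ⟨hr, .deref h₁ fun _ => hr⟩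
  | assign h₁ _ =>
    have hr := hσ.resolved (BCtx.scoped_plug hg).1
    exact ⟨hr, .assign h₁ fun _ => hr⟩

theorem StoreScoped.of_lookup {z : ℕ} {Ψ : SimpleStoreTy} {σ : Store} (hσ : StoreScoped z Ψ σ)
    {l : ℕ} {A : SimpleTy} {ι : Intro} (hl : Ψ l = some A) (hι : σ.lookup l = some ι) :
    Scoped z Ψ [] ι.toNode A := by
  obtain ⟨ι', hι', h⟩ := hσ l A hl
  rwa [Option.some.inj (hι.symm.trans hι')]

/-- Serves both allocation, where the typing grows at `l`, and assignment, where the typing is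
unchanged and `l` is overwritten at the same type. -/
theorem StoreScoped.insert {z : ℕ} {Ψ Ψ' : SimpleStoreTy} {σ : Store} (hσ : StoreScoped z Ψ σ)
    (hle : Ψ.Le Ψ') {l : ℕ} {ι : Intro} {A : SimpleTy} (hl : Ψ' l = some A)
    (hι : Scoped z Ψ' [] ι.toNode A) (hne : ∀ l', l' ≠ l → Ψ' l' = Ψ l') :
    StoreScoped z Ψ' (σ.insert l ι) := by
  intro l' A' h'
  by_cases e : l' = l
  · subst e
    cases hl.symm.trans h'
    exact ⟨ι, Finmap.lookup_insert _, hι⟩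
  · obtain ⟨ι', h₁, h₂⟩ := hσ l' A' ((hne l' e).symm.trans h')
    exact ⟨ι', by rwa [Finmap.lookup_insert_of_ne _ e], h₂.mono hle⟩

theorem Step.scoped {z : ℕ} {m : Mode} {C C' : Config} {e : AnnBinding} (h : Step m C e C')
    (hC : C.Scoped z) : C'.Scoped z := by
  obtain ⟨rfl, Ψ, A, hσ, hg⟩ := hC
  refine ⟨by cases h <;> rfl, ?_⟩
  cases h with
  | @beta σ z l₁ l₂ B g δ₁ δ₂ h₁ _ =>
    obtain ⟨hδ, A', hb, hplug⟩ := BCtx.scoped_plug hg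
    refine ⟨Ψ, A, hσ, ?_⟩
    cases hb with
    | app hx hy =>
      cases hσ.of_lookup hx h₁ with
      | lam hg' hδ₂ =>
        exact hplug (Scoped.inst (Γ' := []) hg' hδ hy) (DepScoped.inst (Γ' := []) hδ₂ hδ hy)
  | letloc _ =>
    obtain ⟨A', hb, hplug⟩ := GCtx.scoped_plug hg
    refine ⟨Ψ, A, hσ, ?_⟩
    cases hb with
    | letin hb hδ hg' =>
      cases hb with
      | ret hx =>
        exact (hplug (fun _ _ => id)
          (Scoped.inst (Γ' := []) hg' (depScoped_nil_iff.1 hδ) hx)).1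
  | @intro σ z l G ι g δ h₁ _ =>
    obtain ⟨A', hb, hplug⟩ := GCtx.scoped_plug hg
    cases hb with
    | @letin _ _ _ _ _ A₁ _ hb hδ hg' =>
      -- Every typed location is in the store, so a fresh one is untyped and the update is an
      -- extension.
      have hle : Ψ.Le (Function.update Ψ l (some A₁)) := by
        intro l' A₂ h'
        rw [Function.update_of_ne, h']
        rintro rfl
        obtain ⟨ι', h'', -⟩ := hσ _ _ h'
        exact h₁ (Finmap.mem_of_lookup_eq_some h'')
      have hl : Function.update Ψ l (some A₁) l = some A₁ := Function.update_self ..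
      refine ⟨Function.update Ψ l (some A₁), A, hσ.insert hle hl (hb.mono hle)
        fun l' h' => Function.update_of_ne h' .., ?_⟩
      have hp := hplug hle (Scoped.inst (Γ' := []) (hg'.mono hle)
        (depScoped_nil_iff.1 (hδ.mono hle)) hl)
      exact GCtx.scoped_propagate ι hp.1 (hp.2 l (by simp))
  | @deref σ z l w l' B δ h₁ _ =>
    obtain ⟨hδ, A', hb, hplug⟩ := BCtx.scoped_plug hg
    refine ⟨Ψ, A, hσ, ?_⟩
    cases hb with
    | deref hx =>
      cases hσ.of_lookup hx h₁ with
      | ref _ hl' => exact hplug (.ret hl') (depScoped_nil_iff.2 hδ)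
  | @assign σ z l w l' l'' B δ h₁ _ =>
    obtain ⟨hδ, A', hb, hplug⟩ := BCtx.scoped_plug hg
    cases hb with
    | assign hx hy =>
      cases hσ.of_lookup hx h₁ with
      | ref hw _ =>
        -- The capability `w` is kept, so its type comes from the old cell.
        exact ⟨Ψ, A, hσ.insert (fun _ _ => id) hx (.ref hw hy) fun _ _ => rfl,
          hplug (.const .unit) (depScoped_nil_iff.2 hδ)⟩

/-! ### Progress. -/

theorem exists_loc_of_nameTy_nil {Ψ : SimpleStoreTy} {x : Name} {A : SimpleTy}
    (h : nameTy Ψ [] x = some A) : ∃ l, x = .loc l ∧ Ψ l = some A := by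
  cases x with
  | var i => simp [nameTy] at h
  | loc l => exact ⟨l, rfl, h⟩
  | start z => simp [nameTy] at h

/-- The same rule applies with one more outermost frame on the context; only the existence of a
successor matters. -/
theorem Step.exists_letin {m : Mode} {σ : Store} {z : ℕ} {b : Tm .graph} {δ : Deps}
    {e : AnnBinding} {C' : Config} (h : Step m ⟨σ, z, (b, δ)⟩ e C') (g : Tm .graph) (δ₀ : Deps) :
    ∃ C'', Step m ⟨σ, z, (.letin b δ g, δ₀)⟩ e C'' := by
  generalize hC : (⟨σ, z, (b, δ)⟩ : Config) = C at h
  cases h with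
  | @beta _ _ _ l₂ B _ _ _ h₁ h₂ =>
    obtain ⟨rfl, rfl, hb⟩ := Config.mk.inj hC
    have := Step.beta (l₂ := l₂) (B := B.letin g δ₀) h₁ h₂
    rw [BCtx.plug, ← hb] at this
    exact ⟨_, this⟩
  | @letloc _ _ l G g' _ h₂ =>
    obtain ⟨rfl, rfl, hb⟩ := Config.mk.inj hC
    have := Step.letloc (l := l) (g := g') (G := G.letin g δ₀) h₂
    rw [GCtx.plug, ← hb] at this
    exact ⟨_, this⟩
  | @intro _ _ _ G ι g' _ h₁ h₂ =>
    obtain ⟨rfl, rfl, hb⟩ := Config.mk.inj hC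
    have := Step.intro (ι := ι) (g := g') (G := G.letin g δ₀) h₁ h₂
    rw [GCtx.plug, ← hb] at this
    exact ⟨_, this⟩
  | @deref _ _ _ _ _ B _ h₁ h₂ =>
    obtain ⟨rfl, rfl, hb⟩ := Config.mk.inj hC
    have := Step.deref (B := B.letin g δ₀) h₁ h₂
    rw [BCtx.plug, ← hb] at this
    exact ⟨_, this⟩
  | @assign _ _ _ _ _ l'' B _ h₁ h₂ =>
    obtain ⟨rfl, rfl, hb⟩ := Config.mk.inj hC
    have := Step.assign (l'' := l'') (B := B.letin g δ₀) h₁ h₂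
    rw [BCtx.plug, ← hb] at this
    exact ⟨_, this⟩

theorem exists_step_intro (σ : Store) (z : ℕ) (ι : Intro) (δ : Deps) (g : Tm .graph) (δ₀ : Deps) :
    ∃ e C', Step .unchecked ⟨σ, z, (.letin ι.toNode δ g, δ₀)⟩ e C' := by
  obtain ⟨l, hl⟩ := Infinite.exists_notMem_finset σ.keys
  exact ⟨_, _, .intro (G := .hole δ₀) (fun h => hl (Finmap.mem_keys.2 h)) nofun⟩

/-- Progress for graph terms, and for bindings of arbitrary kind in a `let`. -/
theorem Scoped.progress {z : ℕ} {Ψ : SimpleStoreTy} {σ : Store} (hσ : StoreScoped z Ψ σ)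
    {k : Kind} {t : Tm k} {A : SimpleTy} (h : Scoped z Ψ [] t A) :
    (∀ δ g δ₀, ∃ e C', Step .unchecked ⟨σ, z, (.letin t δ g, δ₀)⟩ e C') ∧
    ∀ g : Tm .graph, ∀ hk : k = .graph, hk ▸ t = g → ∀ δ₀,
      (∃ l, l ∈ σ ∧ g = .ret (.loc l)) ∨ ∃ e C', Step .unchecked ⟨σ, z, (g, δ₀)⟩ e C' := by
  -- The two claims differ only for a location: alone it is final, but bound by a `let` it still
  -- reduces. The kind equation dismisses nodes in the second claim.
  generalize hΓ : ([] : List SimpleTy) = Γ at h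
  induction h with
  | const c => exact ⟨fun δ g δ₀ => exists_step_intro σ z (.const c) δ g δ₀, nofun⟩
  | lam _ _ _ => exact ⟨fun δ g δ₀ => exists_step_intro σ z (.lam _ _) δ g δ₀, nofun⟩
  | app hx hy =>
    subst hΓ
    refine ⟨fun δ g δ₀ => ?_, nofun⟩
    obtain ⟨l₁, rfl, h₁⟩ := exists_loc_of_nameTy_nil hx
    obtain ⟨l₂, rfl, h₂⟩ := exists_loc_of_nameTy_nil hy
    obtain ⟨ι, hι, ht⟩ := hσ _ _ h₁
    -- Canonical forms: a stored entry of function type must be a λ.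
    cases ι with
    | const c => cases ht
    | lam g' δ' => exact ⟨_, _, .beta (B := .hole g δ₀) hι nofun⟩
    | ref w l => cases ht
  | ref hx hy =>
    subst hΓ
    obtain ⟨w, rfl, -⟩ := exists_loc_of_nameTy_nil hx
    obtain ⟨l, rfl, -⟩ := exists_loc_of_nameTy_nil hy
    exact ⟨fun δ g δ₀ => exists_step_intro σ z (.ref w l) δ g δ₀, nofun⟩
  | deref hx =>
    subst hΓ
    refine ⟨fun δ g δ₀ => ?_, nofun⟩
    obtain ⟨l, rfl, h₁⟩ := exists_loc_of_nameTy_nil hx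
    obtain ⟨ι, hι, ht⟩ := hσ _ _ h₁
    cases ι with
    | const c => cases ht
    | lam g' δ' => cases ht
    | ref w l' => exact ⟨_, _, .deref (B := .hole g δ₀) hι nofun⟩
  | assign hx hy =>
    subst hΓ
    refine ⟨fun δ g δ₀ => ?_, nofun⟩
    obtain ⟨l, rfl, h₁⟩ := exists_loc_of_nameTy_nil hx
    obtain ⟨l'', rfl, -⟩ := exists_loc_of_nameTy_nil hy
    obtain ⟨ι, hι, ht⟩ := hσ _ _ h₁
    cases ι with
    | const c => cases ht
    | lam g' δ' => cases ht
    | ref w l' => exact ⟨_, _, .assign (B := .hole g δ₀) hι nofun⟩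
  | ret hx =>
    subst hΓ
    obtain ⟨l, rfl, h₁⟩ := exists_loc_of_nameTy_nil hx
    obtain ⟨ι, hι, -⟩ := hσ _ _ h₁
    refine ⟨fun δ g δ₀ => ⟨_, _, .letloc (G := .hole δ₀) nofun⟩, ?_⟩
    rintro g - rfl δ₀
    exact Or.inl ⟨l, Finmap.mem_of_lookup_eq_some hι, rfl⟩
  | letin hb hδ hg ihb ihg =>
    refine ⟨fun δ g δ₀ => ?_, ?_⟩
    -- The inner `let` steps by induction, with the outer annotation `δ` as its own, and the outer
    -- frame is then put around it.
    · obtain ⟨e, C', h⟩ := (ihb hΓ).1 _ _ δ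
      exact ⟨e, h.exists_letin g δ₀⟩
    · rintro g - rfl δ₀
      exact Or.inr ((ihb hΓ).1 _ _ δ₀)

theorem Config.Scoped.progress {z : ℕ} {C : Config} (h : C.Scoped z) :
    C.IsFinal ∨ ∃ e C', Step .checked C e C' := by
  have hC := h
  obtain ⟨σ, z', g, δ⟩ := C
  obtain ⟨rfl, Ψ, A, hσ, hg⟩ := h
  refine ((hg.progress hσ).2 g rfl rfl δ).imp id ?_
  rintro ⟨e, C', hs⟩
  exact ⟨e, C', (hs.resolved hC).2⟩

theorem Reaches.scoped {z : ℕ} {m : Mode} {C C' : Config} (h : Reaches m C C')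
    (hC : C.Scoped z) : C'.Scoped z := by
  induction h with
  | refl => exact hC
  | tail _ hs ih =>
    obtain ⟨e, hs⟩ := hs
    exact hs.scoped ih

end GraphIR

theorem mainTheorem3
    (S : GraphIR.StoreTy) (σ : GraphIR.Store) (z : ℕ)
    (g : GraphIR.Tm .graph) (δ : GraphIR.Deps)
    (T : GraphIR.Ty) (q ε : GraphIR.Qual)
    (hg : GraphIR.ConfigTyping [] S S.dom z g δ T q ε)
    (hσ : GraphIR.StoreTyping [] S S.dom (GraphIR.pointsTo [] S (.start z)) σ)
    (C : GraphIR.Config) (hC : GraphIR.Reaches .unchecked ⟨σ, z, (g, δ)⟩ C) :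
    (∀ e C', GraphIR.Step .unchecked C e C' →
      GraphIR.Resolved C.store z e.deps ∧ GraphIR.Step .checked C e C') ∧
    (C.IsFinal ∨ ∃ e C', GraphIR.Step .checked C e C') := by
  -- The initial last-use map sends exactly the names in scope to `z`, so it is scoped.
  have h : C.Scoped z := hC.scoped ⟨rfl, S.erase, T.erase, hσ.storeScoped,
    hg.1.scoped (.const_start fun _ => GraphIR.isSome_nameTy_of_mem_names)⟩
  exact ⟨fun e C' hs => hs.resolved h, h.progress⟩
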